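/- Let $d\ge 1$ and let $\mathcal X_d=\{\langle k,i\rangle : k\ge 0,\ 1\le i\le d\}$ be a countable set of types; the type $\langle k,i\rangle$ is said to be in level $k$. For each type $j$ let $p_j$ be a probability distribution on the vectors $\boldsymbol r\in\mathbb N_0^{\mathcal X_d}$ such that, if $j$ is in level $k$, then $p_j$ is supported on vectors with $r_\ell=0$ for all types $\ell$ in levels above $k+1$. Let $\{\boldsymbol Z_n\}_{n\ge0}$ be the multitype Galton--Watson process with these offspring laws (a block lower Hessenberg branching process): each individual lives for one generation, and an individual of type $j$ has $r_\ell$ children of type $\ell$ for each $\ell$, where $\boldsymbol r$ has law $p_j$ and is independent of the offspring vectors of all other individuals. $Z_{n,\ell}$ is the number of type-$\ell$ individuals in generation $n$, and $\mathbb P_i$ is the law of the process started from a single individual of type $i$. Let $M(i,j)=\sum_{\boldsymbol r}p_i(\boldsymbol r)\,r_j\in[0,\infty]$ be the expected number of type-$j$ children of a type-$i$ individual, and consider the directed graph on $\mathcal X_d$ with an edge from $i$ to $j$ whenever $M(i,j)>0$. Let $T_k$ be the set of types in levels $0,\dots,k$. For $A\subseteq\mathcal X_d$ and $i\in\mathcal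 X_d$ define: - $q_i(A)=\mathbb P_i\big(\exists n\ \forall m\ge n\ \forall \ell\in A:\ Z_{m,\ell}=0\big)$, the probability of eventual extinction in $A$; - $\{\tilde{\boldsymbol Z}{}^{(A)}_n\}$, the process obtained from $\{\boldsymbol Z_n\}$ by making all individuals with type outside $A$ sterile (they have no children), and $\tilde q^{(A)}_i$, the probability under $\mathbb P_i$ that this process becomes globally extinct, that is, that it is empty from some generation on; - for $k,\ell\ge0$, $q^{(k,\ell)}_i(A)$, the probability under $\mathbb P_i$ that $\{\tilde{\boldsymbol Z}{}^{(A\cup T_\ell)}_n\}$ becomes globally extinct without ever containing an individual (the initial one included) with type in $A\setminus T_k$. Equivalently, this is the extinction probability of the process modified so that the types in $A\setminus T_k$ are immortal and the types outside $A\cup T_\ell$ are sterile. **Theorem.** Let $A\subseteq\mathcal X_d$ be such that from every type there is a path (possibly of length zero) in this graph to some type in $A$; this holds in particular if $A\neq\varnothing$ and the process is irreducible, that is, any two types are joined by a path in each direction. If $$\sup_{i\in A}\tilde q^{(A)}_i<1,$$ then $$\lim_{k\to\infty}q^{(k,k)}_i(A)=q_i(A)\qquad\text{for every } i\in\mathcal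 X_d .$$ -/

import Mathlib

open MeasureTheory Filter Topology
open scoped ENNReal

/-- The type set: a type `(k, i)` is in level `k` and phase `i`. -/
abbrev TypeSet (d : ℕ) : Type := ℕ × Fin d

/-- Offspring vectors. In a block lower Hessenberg process an individual has no offspring beyond
the next level, so that all its possible offspring vectors have finite support. -/
abbrev Offspring (d : ℕ) : Type := TypeSet d →₀ ℕ

instance Offspring.instMeasurableSpace (d : ℕ) : MeasurableSpace (Offspring d) := ⊤

/-- The reproduction laws of a block lower Hessenberg branching process with `d` phases:
`p i` is the law of the offspring vector of an individual of type `i`, and an individual in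
level `k` has no offspring in any level above `k + 1`. -/
structure BlockLHBP (d : ℕ) where
  p : TypeSet d → PMF (Offspring d)
  lowerHessenberg : ∀ i : TypeSet d, ∀ r ∈ (p i).support,
    ∀ j : TypeSet d, i.1 + 1 < j.1 → r j = 0

/-- Virtual individuals. `(i, [(cₙ, jₙ), …, (c₁, j₁)])` is the child number `cₙ` of type `jₙ` of
the individual `(i, [(cₙ₋₁, jₙ₋₁), …, (c₁, j₁)])`, and `(i, [])` is the root, which has type `i`.
The children of each type are numbered from `0` on. -/
abbrev Individual (d : ℕ) : Type := TypeSet d × List (ℕ × TypeSet d)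

/-- The type of a virtual individual. -/
def Individual.type {d : ℕ} : Individual d → TypeSet d
  | (i, []) => i
  | (_, (_, j) :: _) => j

/-- The sample space: an offspring vector for each virtual individual. -/
abbrev SampleSpace (d : ℕ) : Type := Individual d → Offspring d

/-- The population in generation `n` when the root has type `i` and the offspring vectors are
given by `N`. -/
def population {d : ℕ} (N : SampleSpace d) (i : TypeSet d) : ℕ → Set (Individual d)
  | 0 => {(i, [])}
  | n + 1 => {x | ∃ y ∈ population N i n, ∃ (c : ℕ) (j : TypeSet d),
      c < N y j ∧ x = (y.1, (c, j) :: y.2)}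

/-- `popVector N i n j` is the number of type-`j` individuals in generation `n`, when the root has
type `i`. -/
noncomputable def popVector {d : ℕ} (N : SampleSpace d) (i : TypeSet d) (n : ℕ)
    (j : TypeSet d) : ℕ∞ :=
  {x ∈ population N i n | x.type = j}.encard

/-- The event that, from generation `n` on, no individual with type in `A` is in the population
that starts with a root of type `i`. -/
def extinctFrom {d : ℕ} (i : TypeSet d) (A : Set (TypeSet d)) (n : ℕ) : Set (SampleSpace d) :=
  {N | ∀ m, n ≤ m → ∀ j ∈ A, popVector N i m j = 0}

/-- The event of eventual extinction in `A`. -/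
def extinct {d : ℕ} (i : TypeSet d) (A : Set (TypeSet d)) : Set (SampleSpace d) :=
  ⋃ n, extinctFrom i A n

open Classical in
/-- The offspring vectors after all individuals with type outside `A` have been made sterile. -/
noncomputable def sterilize {d : ℕ} (A : Set (TypeSet d)) (N : SampleSpace d) : SampleSpace d :=
  fun I => if I.type ∈ A then N I else 0

/-- The types whose level is at most `k`. -/
def levelsUpTo (d k : ℕ) : Set (TypeSet d) := {i | i.1 ≤ k}

namespace BlockLHBP

variable {d : ℕ} (Z : BlockLHBP d)

/-- The law of the family of offspring vectors: they are independent, and an individual of type `i`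
has an offspring vector with law `p i`. -/
noncomputable def prob : Measure (SampleSpace d) :=
  Measure.infinitePi fun I : Individual d => (Z.p I.type).toMeasure

/-- The mean progeny matrix: `mean i j` is the expected number of type-`j` children of an
individual of type `i`. -/
noncomputable def mean (i j : TypeSet d) : ℝ≥0∞ := ∑' r : Offspring d, Z.p i r * (r j : ℝ≥0∞)

/-- There is a path (of length at least zero) from `i` to `j` in the mean progeny representation
graph, which has an edge from `a` to `b` if and only if `mean a b > 0`. -/
def HasPath (i j : TypeSet d) : Prop := Relation.ReflTransGen (fun a b => 0 < Z.mean a b) i j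

/-- The probability `q_i(A)` of eventual extinction in `A`, starting from a root of type `i`. -/
noncomputable def q (A : Set (TypeSet d)) (i : TypeSet d) : ℝ≥0∞ := Z.prob (extinct i A)

/-- The global extinction probability of the process in which all individuals with type outside
`A` are sterile. -/
noncomputable def qSterile (A : Set (TypeSet d)) (i : TypeSet d) : ℝ≥0∞ :=
  Z.prob {N | sterilize A N ∈ extinct i Set.univ}

/-- The extinction probability of the truncated process, in which the types outside `A` in a level
above `l` are sterile and the types in `A` in a level above `k` are immortal: the probability that
the process in which all individuals with type outside `A ∪ levelsUpTo d l` are sterile becomes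
globally extinct without ever containing an individual with type in `A \ levelsUpTo d k`. -/
noncomputable def qTrunc (A : Set (TypeSet d)) (k l : ℕ) (i : TypeSet d) : ℝ≥0∞ :=
  Z.prob {N | sterilize (A ∪ levelsUpTo d l) N ∈ extinct i Set.univ ∧
    sterilize (A ∪ levelsUpTo d l) N ∈ extinctFrom i (A \ levelsUpTo d k) 0}

end BlockLHBP

open ProbabilityTheory

/-! The indicators of the truncated extinction events converge almost surely to that of extinction
in `A`, and bounded convergence finishes. Write `T_k` for `levelsUpTo d k`. If `A` becomes extinct,
so does every `T_k`: this set is finite, so `A` is reached from it with probability bounded below,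
and infinitely many visits to `T_k` would force infinitely many to `A`
(`ae_mem_extinct_levelsUpTo`). Only finitely many individuals precede the extinction of `A`, so for
large `k` none has a type in `A \ T_k`, and the truncated process dies out. If `A` does not become
extinct, its members make infinitely many attempts at survival within `A`, each succeeding with
probability at least `1 - sup`, so one succeeds (`ae_exists_survives`). Its finite ancestry is in
`T_k` for large `k`, so the truncated process survives. Both almost sure claims rest on Lévy's 0-1
law (`ae_mem_of_frequently`). -/

theorem measurableSet_offspring {d : ℕ} (s : Set (Offspring d)) : MeasurableSet s :=
  MeasurableSpace.measurableSet_top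

/-- The offspring vectors of the tree rooted at type `i`, indexed by the line of descent. -/
abbrev FamilyTree (d : ℕ) : Type := List (ℕ × TypeSet d) → Offspring d

/-- The line of descent `l` is realized in the tree `M`. -/
def FamilyTree.Alive {d : ℕ} (M : FamilyTree d) : List (ℕ × TypeSet d) → Prop
  | [] => True
  | (c, j) :: l => FamilyTree.Alive M l ∧ c < M l j

/-- The tree of the descendants of the individual `u`. -/
def FamilyTree.shift {d : ℕ} (M : FamilyTree d) (u : List (ℕ × TypeSet d)) : FamilyTree d :=
  fun l => M (l ++ u)

open Classical in
/-- The tree with root of type `i` after all types outside `A` have been made sterile. -/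
noncomputable def FamilyTree.sterile {d : ℕ} (A : Set (TypeSet d)) (i : TypeSet d)
    (M : FamilyTree d) : FamilyTree d :=
  fun l => if Individual.type (i, l) ∈ A then M l else 0

/-- The family tree of the root of type `i`. -/
def SampleSpace.tree {d : ℕ} (N : SampleSpace d) (i : TypeSet d) : FamilyTree d :=
  fun l => N (i, l)

/-! ### Deterministic family trees -/

namespace FamilyTree

variable {d : ℕ} {M : FamilyTree d} {A B : Set (TypeSet d)} {i : TypeSet d}
  {l u : List (ℕ × TypeSet d)}

/-- Lines of descent grow at the head, so in `l ++ u` the ancestor is `u` and `l` is the descent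
from it. -/
theorem alive_append : M.Alive (l ++ u) ↔ M.Alive u ∧ (M.shift u).Alive l := by
  induction l with
  | nil => simp [Alive]
  | cons a l ih =>
    obtain ⟨c, j⟩ := a
    simp only [List.cons_append, Alive, ih, shift, and_assoc]

theorem type_append :
    Individual.type (i, l ++ u) = Individual.type (Individual.type (i, u), l) := by
  rcases l with _ | ⟨⟨c, j⟩, l⟩ <;> simp [Individual.type]

theorem shift_sterile :
    (M.sterile A i).shift u = (M.shift u).sterile A (Individual.type (i, u)) := by
  funext l
  simp only [shift, sterile]
  rw [type_append]

/-- Sterility constrains the parent only: types outside `A` still appear, as leaves. -/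
theorem alive_sterile_cons {c : ℕ} {j : TypeSet d} :
    (M.sterile A i).Alive ((c, j) :: l) ↔
      (M.sterile A i).Alive l ∧ Individual.type (i, l) ∈ A ∧ c < M l j := by
  by_cases h : Individual.type (i, l) ∈ A <;> simp [Alive, sterile, h]

theorem Alive.sterile_mono (hAB : A ⊆ B) (h : (M.sterile A i).Alive l) :
    (M.sterile B i).Alive l := by
  induction l with
  | nil => trivial
  | cons a l ih =>
    obtain ⟨c, j⟩ := a
    rw [alive_sterile_cons] at h ⊢
    exact ⟨ih h.1, hAB h.2.1, h.2.2⟩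

theorem Alive.of_sterile (h : (M.sterile A i).Alive l) : M.Alive l := by
  induction l with
  | nil => trivial
  | cons a l ih =>
    obtain ⟨c, j⟩ := a
    rw [alive_sterile_cons] at h
    exact ⟨ih h.1, h.2.2⟩

theorem Alive.exists_sterile (h : M.Alive l) :
    ∃ K, ∀ k, K ≤ k → (M.sterile (A ∪ levelsUpTo d k) i).Alive l := by
  induction l with
  | nil => exact ⟨0, fun _ _ => trivial⟩
  | cons a l ih =>
    obtain ⟨c, j⟩ := a
    obtain ⟨K, hK⟩ := ih h.1
    refine ⟨max K (Individual.type (i, l)).1, fun k hk => alive_sterile_cons.2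
      ⟨hK k ((le_max_left _ _).trans hk), Or.inr ?_, h.2⟩⟩
    exact (le_max_right _ _).trans hk

theorem finite_generation (M : FamilyTree d) (n : ℕ) :
    {l : List (ℕ × TypeSet d) | l.length = n ∧ M.Alive l}.Finite := by
  induction n with
  | zero => exact (Set.finite_singleton []).subset fun l hl => List.length_eq_zero_iff.1 hl.1
  | succ n ih =>
    refine (ih.biUnion (t := fun l => ⋃ j ∈ ((M l).support : Set (TypeSet d)),
      (fun c => (c, j) :: l) '' Set.Iio (M l j)) fun l _ => Set.Finite.biUnion
        (Finset.finite_toSet _) fun j _ => (Set.finite_Iio _).image _).subset ?_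
    rintro (_ | ⟨⟨c, j⟩, l⟩) ⟨hl, ha⟩
    · simp at hl
    · simp only [List.length_cons, Nat.add_right_cancel_iff] at hl
      have hc := ha.2
      simp only [Set.mem_iUnion]
      exact ⟨l, ⟨hl, ha.1⟩, j, by simp; omega, c, hc, rfl⟩

theorem finite_alive_lt (M : FamilyTree d) (n : ℕ) :
    {l : List (ℕ × TypeSet d) | l.length < n ∧ M.Alive l}.Finite := by
  refine ((Set.finite_Iio n).biUnion fun m _ => M.finite_generation m).subset ?_
  rintro l ⟨hl, ha⟩
  simp only [Set.mem_iUnion]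
  exact ⟨l.length, hl, rfl, ha⟩

end FamilyTree

theorem mem_population_iff {d : ℕ} {N : SampleSpace d} {i : TypeSet d} {n : ℕ}
    {x : Individual d} :
    x ∈ population N i n ↔ x.1 = i ∧ x.2.length = n ∧ (N.tree i).Alive x.2 := by
  induction n generalizing x with
  | zero =>
    obtain ⟨r, l⟩ := x
    simp only [population, Set.mem_singleton_iff, Prod.mk.injEq, List.length_eq_zero_iff]
    constructor
    · rintro ⟨rfl, rfl⟩; exact ⟨rfl, rfl, trivial⟩
    · rintro ⟨h, h', -⟩; exact ⟨h, h'⟩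
  | succ n ih =>
    simp only [population, Set.mem_ofPred_eq, ih]
    constructor
    · rintro ⟨⟨r, l⟩, ⟨rfl, hl, ha⟩, c, j, hc, rfl⟩
      exact ⟨rfl, by simpa using hl, ha, hc⟩
    · obtain ⟨r, l⟩ := x
      rintro ⟨rfl, hl, ha⟩
      rcases l with _ | ⟨⟨c, j⟩, l⟩
      · simp at hl
      · exact ⟨(r, l), ⟨rfl, by simpa using hl, ha.1⟩, c, j, ha.2, rfl⟩

theorem mem_extinctFrom_iff {d : ℕ} {N : SampleSpace d} {i : TypeSet d} {A : Set (TypeSet d)}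
    {n : ℕ} : N ∈ extinctFrom i A n ↔
      ∀ l, n ≤ l.length → (N.tree i).Alive l → Individual.type (i, l) ∉ A := by
  simp only [extinctFrom, popVector, Set.mem_ofPred_eq, Set.encard_eq_zero,
    Set.eq_empty_iff_forall_notMem, mem_population_iff]
  constructor
  · intro h l hl ha hA
    exact h _ hl _ hA (i, l) ⟨⟨rfl, rfl, ha⟩, rfl⟩
  · rintro h m hm j hj ⟨r, l⟩ ⟨⟨rfl, rfl, ha⟩, rfl⟩
    exact h l hm ha hj

theorem mem_extinct_iff {d : ℕ} {N : SampleSpace d} {i : TypeSet d} {A : Set (TypeSet d)} :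
    N ∈ extinct i A ↔
      ∃ n, ∀ l, n ≤ l.length → (N.tree i).Alive l → Individual.type (i, l) ∉ A := by
  simp only [extinct, Set.mem_iUnion, mem_extinctFrom_iff]

theorem tree_sterilize {d : ℕ} (A : Set (TypeSet d)) (N : SampleSpace d) (i : TypeSet d) :
    SampleSpace.tree (sterilize A N) i = (N.tree i).sterile A i := rfl

/-! ### Measurability -/

namespace FamilyTree

/-- The set of trees in which the line of descent `l` is realized is measurable. -/
theorem measurableSet_alive {d : ℕ} (l : List (ℕ × TypeSet d)) :
    MeasurableSet {M : FamilyTree d | M.Alive l} := by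
  induction l with
  | nil => exact MeasurableSet.univ
  | cons a l ih =>
    obtain ⟨c, j⟩ := a
    have h : Measurable fun M : FamilyTree d => M l := measurable_pi_apply l
    exact ih.inter (h (measurableSet_offspring {r | c < r j}))

theorem measurable_sterile {d : ℕ} (A : Set (TypeSet d)) (i : TypeSet d) :
    Measurable (sterile A i) := by
  refine measurable_pi_iff.2 fun l => ?_
  by_cases h : Individual.type (i, l) ∈ A
  · simpa [sterile, h] using measurable_pi_apply l
  · simp [sterile, h]

theorem measurable_shift {d : ℕ} (u : List (ℕ × TypeSet d)) :
    Measurable (fun M : FamilyTree d => M.shift u) :=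
  measurable_pi_iff.2 fun l => measurable_pi_apply (l ++ u)

/-- The trees in which a type in `A` occurs in or after generation `n`. -/
def hits {d : ℕ} (A : Set (TypeSet d)) (i : TypeSet d) (n : ℕ) : Set (FamilyTree d) :=
  {M | ∃ l, n ≤ l.length ∧ M.Alive l ∧ Individual.type (i, l) ∈ A}

theorem measurableSet_hits {d : ℕ} (A : Set (TypeSet d)) (i : TypeSet d) (n : ℕ) :
    MeasurableSet (hits A i n) := by
  have : hits A i n = ⋃ l, ⋃ (_ : n ≤ l.length ∧ Individual.type (i, l) ∈ A),
      {M : FamilyTree d | M.Alive l} := by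
    ext M; simp only [hits, Set.mem_ofPred_eq, Set.mem_iUnion, exists_prop]; grind
  rw [this]
  exact .iUnion fun l => .iUnion fun _ => measurableSet_alive l

/-- The trees that survive after all types outside `A` have been made sterile. -/
def survives {d : ℕ} (A : Set (TypeSet d)) (i : TypeSet d) : Set (FamilyTree d) :=
  {M | ∀ n, M.sterile A i ∈ hits Set.univ i n}

theorem measurableSet_survives {d : ℕ} (A : Set (TypeSet d)) (i : TypeSet d) :
    MeasurableSet (survives A i) := by
  rw [survives, Set.ofPred_forall]
  exact .iInter fun n => measurable_sterile A i (measurableSet_hits _ _ _)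

end FamilyTree

theorem measurable_tree {d : ℕ} (i : TypeSet d) :
    Measurable (fun N : SampleSpace d => N.tree i) :=
  measurable_pi_iff.2 fun l => measurable_pi_apply (i, l)

theorem mem_extinctFrom_iff_notMem_hits {d : ℕ} {N : SampleSpace d} {i : TypeSet d}
    {A : Set (TypeSet d)} {n : ℕ} :
    N ∈ extinctFrom i A n ↔ N.tree i ∉ FamilyTree.hits A i n := by
  simp only [mem_extinctFrom_iff, FamilyTree.hits, Set.mem_ofPred_eq]; grind

theorem measurableSet_extinctFrom {d : ℕ} (i : TypeSet d) (A : Set (TypeSet d)) (n : ℕ) :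
    MeasurableSet (extinctFrom i A n) := by
  have : extinctFrom i A n = (fun N : SampleSpace d => N.tree i) ⁻¹' (FamilyTree.hits A i n)ᶜ := by
    ext N; exact mem_extinctFrom_iff_notMem_hits
  rw [this]
  exact measurable_tree i (FamilyTree.measurableSet_hits A i n).compl

theorem measurableSet_extinct {d : ℕ} (i : TypeSet d) (A : Set (TypeSet d)) :
    MeasurableSet (extinct i A) := .iUnion fun n => measurableSet_extinctFrom i A n

theorem measurable_sterilize {d : ℕ} (A : Set (TypeSet d)) : Measurable (sterilize A) := by
  refine measurable_pi_iff.2 fun I => ?_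
  by_cases h : I.type ∈ A
  · simpa [sterilize, h] using measurable_pi_apply I
  · simp [sterilize, h]

theorem sterilize_mem_extinct_iff {d : ℕ} {N : SampleSpace d} {i : TypeSet d}
    {A : Set (TypeSet d)} :
    sterilize A N ∈ extinct i Set.univ ↔ N.tree i ∉ FamilyTree.survives A i := by
  simp only [extinct, Set.mem_iUnion, mem_extinctFrom_iff_notMem_hits, tree_sterilize,
    FamilyTree.survives, Set.mem_ofPred_eq, not_forall]

/-! ### Information carried by sets of individuals and by generations -/

/-- The `σ`-algebra generated by the offspring vectors of the individuals in `S`. -/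
@[reducible] def offspringSigma {d : ℕ} (S : Set (Individual d)) : MeasurableSpace (SampleSpace d) :=
  ⨆ I ∈ S, MeasurableSpace.comap (fun N : SampleSpace d => N I) inferInstance

theorem measurable_offspring {d : ℕ} {S : Set (Individual d)} {I : Individual d} (hI : I ∈ S) :
    Measurable[offspringSigma S] (fun N : SampleSpace d => N I) :=
  Measurable.mono (comap_measurable _)
    (le_iSup₂ (f := fun I (_ : I ∈ S) =>
      MeasurableSpace.comap (fun N : SampleSpace d => N I) inferInstance) I hI) le_rfl

theorem offspringSigma_le {d : ℕ} (S : Set (Individual d)) :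
    offspringSigma S ≤ MeasurableSpace.pi :=
  iSup₂_le fun I _ => (measurable_pi_apply I).comap_le

theorem offspringSigma_mono {d : ℕ} {S T : Set (Individual d)} (h : S ⊆ T) :
    offspringSigma S ≤ offspringSigma T := biSup_mono fun _ hI => h hI

/-- The information on the offspring vectors in the generations before `n`. -/
def generationFiltration (d : ℕ) :
    Filtration ℕ (MeasurableSpace.pi : MeasurableSpace (SampleSpace d)) where
  seq n := offspringSigma {I | I.2.length < n}
  mono' _ _ h := offspringSigma_mono fun _ hI => lt_of_lt_of_le hI h
  le' _ := offspringSigma_le _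

theorem iSup_generationFiltration (d : ℕ) :
    (MeasurableSpace.pi : MeasurableSpace (SampleSpace d)) ≤ ⨆ n, generationFiltration d n := by
  refine iSup_le fun I => ?_
  refine le_trans ?_ (le_iSup (fun n => generationFiltration d n) (I.2.length + 1))
  exact (measurable_offspring (S := {J | J.2.length < I.2.length + 1})
    (Nat.lt_succ_self _)).comap_le

theorem measurableSet_alive_generationFiltration {d : ℕ} (i : TypeSet d) {n : ℕ}
    {l : List (ℕ × TypeSet d)} (hl : l.length ≤ n) :
    MeasurableSet[generationFiltration d n] {N : SampleSpace d | (N.tree i).Alive l} := by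
  induction l with
  | nil => exact MeasurableSet.univ
  | cons a l ih =>
    obtain ⟨c, j⟩ := a
    rw [List.length_cons] at hl
    have h : MeasurableSet[generationFiltration d n] {N : SampleSpace d | c < N (i, l) j} :=
      measurable_offspring (S := {J : Individual d | J.2.length < n}) (I := (i, l)) hl
        (measurableSet_offspring {r : Offspring d | c < r j})
    exact (ih (by omega)).inter h

/-! ### Branching property and almost sure statements -/

namespace BlockLHBP

variable {d : ℕ} (Z : BlockLHBP d)

instance : IsProbabilityMeasure Z.prob := by unfold prob; infer_instance

theorem iIndep_offspring :
    iIndep (fun I : Individual d =>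
      MeasurableSpace.comap (fun N : SampleSpace d => N I) inferInstance) Z.prob :=
  iIndepFun_infinitePi (P := fun I : Individual d => (Z.p I.type).toMeasure)
    (X := fun _ r => r) (fun _ => measurable_id)

theorem indep_offspringSigma {S T : Set (Individual d)} (h : Disjoint S T) :
    Indep (offspringSigma S) (offspringSigma T) Z.prob :=
  indep_iSup_of_disjoint (fun I => (measurable_pi_apply I).comap_le) Z.iIndep_offspring h

/-- The branching property: the tree of descendants of a virtual individual has the law of the
tree of a root of the same type. -/
theorem map_shift (i : TypeSet d) (u : List (ℕ × TypeSet d)) :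
    Z.prob.map (fun N => (N.tree i).shift u) =
      Z.prob.map (fun N => N.tree (Individual.type (i, u))) := by
  -- Both laws are images of the product measure under injective reindexings, hence products whose
  -- factors agree by `type_append`.
  have h1 := Measure.map_infinitePi_infinitePi_of_inj
    (P := fun I : Individual d => (Z.p I.type).toMeasure)
    (f := fun l => ((i, l ++ u) : Individual d)) (fun a b h => by simpa using h)
  have h2 := Measure.map_infinitePi_infinitePi_of_inj
    (P := fun I : Individual d => (Z.p I.type).toMeasure)
    (f := fun l => ((Individual.type (i, u), l) : Individual d)) (fun a b h => by simpa using h)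
  refine h1.trans (Eq.trans ?_ h2.symm)
  congr 1
  funext l
  rw [FamilyTree.type_append]

theorem prob_shift_mem (i : TypeSet d) (u : List (ℕ × TypeSet d)) {G : Set (FamilyTree d)}
    (hG : MeasurableSet G) :
    Z.prob {N | (N.tree i).shift u ∈ G} = Z.prob {N | N.tree (Individual.type (i, u)) ∈ G} := by
  have h := congrArg (fun μ => μ G) (Z.map_shift i u)
  have hm : Measurable fun N : SampleSpace d => (N.tree i).shift u :=
    (FamilyTree.measurable_shift u).comp (measurable_tree i)
  rwa [Measure.map_apply hm hG,
    Measure.map_apply (measurable_tree _) hG] at h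

theorem measurable_shift_offspringSigma (i : TypeSet d) (u : List (ℕ × TypeSet d)) :
    Measurable[offspringSigma {I : Individual d | u.length ≤ I.2.length}]
      (fun N : SampleSpace d => (N.tree i).shift u) :=
  @measurable_pi_iff _ _ _ (_) _ _ |>.2 fun l =>
    measurable_offspring (I := (i, l ++ u)) (by simp)

theorem indep_shift (u : List (ℕ × TypeSet d)) :
    Indep (offspringSigma {I : Individual d | u.length ≤ I.2.length})
      (generationFiltration d u.length) Z.prob :=
  Z.indep_offspringSigma (Set.disjoint_left.2 fun I (h : u.length ≤ I.2.length) h' =>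
    absurd h' (not_lt.2 h))

/-- The subtree at `u` uses only generations from `u.length` on, which are independent of the
conditioning. -/
theorem condExp_shift (i : TypeSet d) (u : List (ℕ × TypeSet d)) {G : Set (FamilyTree d)}
    (hG : MeasurableSet G) :
    Z.prob[({N | (N.tree i).shift u ∈ G} : Set (SampleSpace d)).indicator (fun _ => (1 : ℝ)) |
        generationFiltration d u.length] =ᵐ[Z.prob]
      fun _ => Z.prob.real {N | N.tree (Individual.type (i, u)) ∈ G} := by
  have hm := measurable_shift_offspringSigma i u hG
  refine (condExp_indep_eq (offspringSigma_le _) ((generationFiltration d).le _)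
    (stronglyMeasurable_const.indicator hm) (Z.indep_shift u)).trans ?_
  refine Eventually.of_forall fun _ => ?_
  have := integral_indicator_const (μ := Z.prob) (1 : ℝ) (offspringSigma_le _ _ hm)
  refine this.trans ?_
  rw [smul_eq_mul, mul_one, measureReal_def, measureReal_def]
  exact congrArg _ (Z.prob_shift_mem i u hG)

/-- If the individuals in `X` cause, independently of the past and with a probability that is
bounded below, the event `H`, and infinitely many generations contain individuals in `X`, then `H`
occurs almost surely. -/
theorem ae_mem_of_frequently (i : TypeSet d) (X : Set (List (ℕ × TypeSet d)))
    (G : List (ℕ × TypeSet d) → Set (FamilyTree d)) (hG : ∀ u, MeasurableSet (G u))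
    {H : Set (FamilyTree d)} (hH : MeasurableSet H) {c : ℝ} (hc : 0 < c)
    (hGc : ∀ u ∈ X, c ≤ Z.prob.real {N : SampleSpace d | N.tree (Individual.type (i, u)) ∈ G u})
    (hGH : ∀ M : FamilyTree d, ∀ u ∈ X, M.Alive u → M.shift u ∈ G u → M ∈ H) :
    ∀ᵐ N : SampleSpace d ∂Z.prob,
      (∀ n, ∃ u ∈ X, n ≤ u.length ∧ (N.tree i).Alive u) → N.tree i ∈ H := by
  set HN : Set (SampleSpace d) := {N | N.tree i ∈ H}
  have hHm : MeasurableSet HN := measurable_tree i hH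
  have hint : Integrable (HN.indicator (fun _ => (1 : ℝ))) Z.prob :=
    (integrable_const _).indicator hHm
  -- Lévy's upward theorem: the conditional probabilities of `H` tend to its indicator.
  have hconv := hint.tendsto_ae_condExp (ℱ := generationFiltration d)
    (stronglyMeasurable_const.indicator (iSup_generationFiltration d _ hHm))
  have hlow : ∀ᵐ N : SampleSpace d ∂Z.prob, ∀ u ∈ X, (N.tree i).Alive u →
      c ≤ (Z.prob[HN.indicator (fun _ => (1 : ℝ)) | generationFiltration d u.length]) N := by
    refine ae_all_iff.2 fun u => ?_
    by_cases hu : u ∈ X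
    swap
    · exact Eventually.of_forall fun _ h => absurd h hu
    set GN : Set (SampleSpace d) := {N | (N.tree i).shift u ∈ G u}
    set BN : Set (SampleSpace d) := {N | (N.tree i).Alive u}
    have hGm : MeasurableSet GN := (FamilyTree.measurable_shift u).comp (measurable_tree i) (hG u)
    have hBm := measurableSet_alive_generationFiltration i (le_refl u.length)
    have hGint : Integrable (GN.indicator (fun _ => (1 : ℝ))) Z.prob :=
      (integrable_const _).indicator hGm
    -- Whether `u` is alive is known at time `u.length`, so this indicator comes out of the
    -- conditional expectation.
    have h1 := condExp_indicator hGint hBm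
    have h2 := Z.condExp_shift i u (hG u)
    have h3 := condExp_mono (m := generationFiltration d u.length)
      (hGint.indicator ((generationFiltration d).le _ _ hBm)) hint
      (Eventually.of_forall fun N : SampleSpace d => by
        rw [Set.indicator_indicator]
        exact Set.indicator_le_indicator_of_subset
          (fun N hN => hGH (SampleSpace.tree N i) u hu hN.1 hN.2) (fun _ => zero_le_one) N)
    filter_upwards [h1, h2, h3] with N h1 h2 h3 _ ha
    rw [h1, Set.indicator_of_mem (show N ∈ {N : SampleSpace d | (N.tree i).Alive u} from ha),
      h2] at h3
    exact (hGc u hu).trans h3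
  filter_upwards [hconv, hlow] with N h1 h2 hX
  -- Off `H` the limit is `0`, against a value at least `c` at infinitely many times.
  by_contra hN
  rw [Set.indicator_of_notMem (show N ∉ HN from hN)] at h1
  obtain ⟨n, hn⟩ := eventually_atTop.1 (h1.eventually_lt_const hc)
  obtain ⟨u, hu, hnu, ha⟩ := hX n
  exact absurd (h2 u hu ha) (not_le.2 (hn _ hnu))

/-- Types that can be reached in the mean progeny representation graph are reached with positive
probability. -/
theorem prob_hits_pos {A : Set (TypeSet d)} {i j : TypeSet d} (hij : Z.HasPath i j) (hj : j ∈ A) :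
    0 < Z.prob {N | N.tree i ∈ FamilyTree.hits A i 0} := by
  induction hij using Relation.ReflTransGen.head_induction_on with
  | refl =>
    have : {N : SampleSpace d | N.tree j ∈ FamilyTree.hits A j 0} = Set.univ :=
      Set.eq_univ_of_forall fun N => ⟨[], le_rfl, trivial, hj⟩
    rw [this, measure_univ]
    exact one_pos
  | @head a b hab _ ih =>
    obtain ⟨r, hr⟩ : ∃ r, Z.p a r * (r b : ℝ≥0∞) ≠ 0 := by
      by_contra! h
      exact hab.ne' (ENNReal.tsum_eq_zero.2 h)
    -- It suffices to follow child number `0` of type `b`, whose subtree is independent of the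
    -- root's offspring.
    have hC : 0 < Z.prob {N | 0 < N (a, []) b} := by
      have h1 : Z.prob {N | 0 < N (a, []) b} = (Z.p a).toMeasure {r | 0 < r b} := by
        have := measurePreserving_eval_infinitePi
          (fun I : Individual d => (Z.p I.type).toMeasure) (a, [])
        exact this.measure_preimage (measurableSet_offspring {r : Offspring d | 0 < r b}).nullMeasurableSet
      rw [h1, pos_iff_ne_zero, Ne,
        PMF.toMeasure_apply_eq_zero_iff _ (measurableSet_offspring _)]
      intro h
      refine Set.disjoint_left.1 h ((Z.p a).mem_support_iff r |>.2 (left_ne_zero_of_mul hr)) ?_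
      have := right_ne_zero_of_mul hr
      exact Nat.pos_of_ne_zero (by exact_mod_cast this)
    have hG := FamilyTree.measurableSet_hits A b 0
    have hCm := measurableSet_alive_generationFiltration a (le_refl [(0, b)].length)
    have hind := (Indep_iff _ _ _).1 (Z.indep_shift [(0, b)]) _ _
      (measurable_shift_offspringSigma a [(0, b)] hG) hCm
    have hC' : {N : SampleSpace d | (N.tree a).Alive [(0, b)]} = {N | 0 < N (a, []) b} := by
      ext N; simp [FamilyTree.Alive, SampleSpace.tree]
    have hsh := Z.prob_shift_mem a [(0, b)] hG
    refine lt_of_lt_of_le (?_ : (0 : ℝ≥0∞) < _) (hind.symm.le.trans (measure_mono ?_))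
    · rw [hC']
      exact ENNReal.mul_pos (hsh.trans_ne ih.ne') hC.ne'
    · rintro N ⟨⟨l, -, hl, hA⟩, hN⟩
      refine ⟨l ++ [(0, b)], Nat.zero_le _, FamilyTree.alive_append.2 ⟨hN, hl⟩, ?_⟩
      rw [FamilyTree.type_append]
      exact hA

theorem finite_levelsUpTo (d k : ℕ) : (levelsUpTo d k).Finite :=
  ((Set.finite_Iic k).prod Set.finite_univ).subset fun _ hi => ⟨hi, trivial⟩

/-- If `A` can be reached from everywhere, then almost surely either the low levels become extinct
or `A` does not. -/
theorem ae_mem_extinct_levelsUpTo {A : Set (TypeSet d)} (hA : ∀ i, ∃ j ∈ A, Z.HasPath i j)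
    (i : TypeSet d) (k : ℕ) :
    ∀ᵐ N ∂Z.prob, N ∈ extinct i A → N ∈ extinct i (levelsUpTo d k) := by
  obtain ⟨c, hc, hcT⟩ : ∃ c : ℝ, 0 < c ∧ ∀ j ∈ levelsUpTo d k,
      c ≤ Z.prob.real {N | N.tree j ∈ FamilyTree.hits A j 0} := by
    have hpos : ∀ j, 0 < Z.prob.real {N | N.tree j ∈ FamilyTree.hits A j 0} := fun j => by
      obtain ⟨a, ha, hp⟩ := hA j
      exact ENNReal.toReal_pos (Z.prob_hits_pos hp ha).ne' (measure_ne_top _ _)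
    rcases (levelsUpTo d k).eq_empty_or_nonempty with h | h
    · exact ⟨1, one_pos, by simp [h]⟩
    · obtain ⟨a, -, ha⟩ := Set.exists_min_image _
        (fun j => Z.prob.real {N | N.tree j ∈ FamilyTree.hits A j 0}) (finite_levelsUpTo d k) h
      exact ⟨_, hpos a, ha⟩
  -- Every `n` is needed: `A` must be hit after its own random extinction time.
  have key := fun n => Z.ae_mem_of_frequently i
    {u | n ≤ u.length ∧ Individual.type (i, u) ∈ levelsUpTo d k}
    (fun u => FamilyTree.hits A (Individual.type (i, u)) 0)
    (fun u => FamilyTree.measurableSet_hits _ _ _) (FamilyTree.measurableSet_hits A i n) hc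
    (fun u hu => hcT _ hu.2) (by
      rintro M u ⟨hu, -⟩ ha ⟨l, -, hl, hlA⟩
      refine ⟨l ++ u, by rw [List.length_append]; omega,
        FamilyTree.alive_append.2 ⟨ha, hl⟩, ?_⟩
      rwa [FamilyTree.type_append])
  filter_upwards [ae_all_iff.2 key] with N hN hext
  by_contra hk
  rw [mem_extinct_iff] at hk hext
  push Not at hk
  obtain ⟨n, hn⟩ := hext
  obtain ⟨l, hl, ha, hlA⟩ := hN n fun m => by
    obtain ⟨u, hu, ha, hT⟩ := hk (max n m)
    exact ⟨u, ⟨(le_max_left _ _).trans hu, hT⟩, (le_max_right _ _).trans hu, ha⟩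
  exact hn l hl ha hlA

/-- If `A` does not become extinct, then almost surely the descendance within `A` of some
individual with type in `A` survives. -/
theorem ae_exists_survives {A : Set (TypeSet d)} (hsup : (⨆ i ∈ A, Z.qSterile A i) < 1)
    (i : TypeSet d) :
    ∀ᵐ N ∂Z.prob, N ∉ extinct i A → ∃ u, Individual.type (i, u) ∈ A ∧ (N.tree i).Alive u ∧
      (N.tree i).shift u ∈ FamilyTree.survives A (Individual.type (i, u)) := by
  have hHm : MeasurableSet {M : FamilyTree d | ∃ u, Individual.type (i, u) ∈ A ∧ M.Alive u ∧
      M.shift u ∈ FamilyTree.survives A (Individual.type (i, u))} := by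
    rw [Set.ofPred_exists]
    refine .iUnion fun u => ?_
    by_cases hu : Individual.type (i, u) ∈ A
    · simp only [hu, true_and]
      exact (FamilyTree.measurableSet_alive u).inter
        (FamilyTree.measurable_shift u (FamilyTree.measurableSet_survives A _))
    · simp [hu]
  have hs := ENNReal.toReal_strict_mono ENNReal.one_ne_top hsup
  rw [ENNReal.toReal_one] at hs
  have key := Z.ae_mem_of_frequently i {u | Individual.type (i, u) ∈ A}
    (fun u => FamilyTree.survives A (Individual.type (i, u)))
    (fun u => FamilyTree.measurableSet_survives A _) hHm (sub_pos.2 hs)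
    (fun u hu => by
      have h1 : Z.qSterile A (Individual.type (i, u)) ≤ ⨆ i ∈ A, Z.qSterile A i :=
        le_iSup₂ (f := fun i (_ : i ∈ A) => Z.qSterile A i) _ hu
      have h2 := ENNReal.toReal_mono (hsup.trans ENNReal.one_lt_top).ne h1
      have h3 : {N : SampleSpace d | N.tree (Individual.type (i, u)) ∈
          FamilyTree.survives A (Individual.type (i, u))} =
          {N | sterilize A N ∈ extinct (Individual.type (i, u)) Set.univ}ᶜ := by
        ext N
        simp only [Set.mem_compl_iff, Set.mem_ofPred_eq, sterilize_mem_extinct_iff, not_not]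
      have hm : MeasurableSet
          {N : SampleSpace d | sterilize A N ∈ extinct (Individual.type (i, u)) Set.univ} :=
        measurable_sterilize A (measurableSet_extinct _ _)
      rw [h3, probReal_compl_eq_one_sub hm]
      exact sub_le_sub_left h2 1)
    (fun M u hu ha hs => ⟨u, hu, ha, hs⟩)
  filter_upwards [key] with N hN hext
  refine hN fun n => ?_
  rw [mem_extinct_iff] at hext
  push Not at hext
  obtain ⟨u, hu, ha, hA⟩ := hext n
  exact ⟨u, hA, hu, ha⟩

end BlockLHBP

/-! ### Pathwise convergence and conclusion -/

theorem eventually_mem_of_mem_extinct {d : ℕ} {N : SampleSpace d} {i : TypeSet d}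
    {A : Set (TypeSet d)} (hA : N ∈ extinct i A) (hT : ∀ k, N ∈ extinct i (levelsUpTo d k)) :
    ∀ᶠ k in atTop, sterilize (A ∪ levelsUpTo d k) N ∈ extinct i Set.univ ∧
      sterilize (A ∪ levelsUpTo d k) N ∈ extinctFrom i (A \ levelsUpTo d k) 0 := by
  obtain ⟨n, hn⟩ := mem_extinct_iff.1 hA
  -- `K` bounds the levels occupied before generation `n`.
  obtain ⟨K, hK⟩ := (((N.tree i).finite_alive_lt n).image
    fun l => (Individual.type (i, l)).1).bddAbove
  filter_upwards [eventually_ge_atTop K] with k hk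
  refine ⟨?_, ?_⟩
  · obtain ⟨m, hm⟩ := mem_extinct_iff.1 (hT k)
    -- The extra generation allows for sterile leaves: the parent must have a type in `A ∪
    -- levelsUpTo d k`, which is already extinct by then.
    refine mem_extinct_iff.2 ⟨max n m + 1, fun l hl ha => ?_⟩
    rcases l with _ | ⟨⟨c, j⟩, l⟩
    · simp at hl
    · rw [List.length_cons] at hl
      rw [tree_sterilize, FamilyTree.alive_sterile_cons] at ha
      exact (ha.2.1.elim (hn l (by omega) ha.1.of_sterile)
        (hm l (by omega) ha.1.of_sterile)).elim
  · refine mem_extinctFrom_iff.2 fun l _ ha hl => ?_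
    rw [tree_sterilize] at ha
    have hln : l.length < n := not_le.1 fun h => hn l h ha.of_sterile hl.1
    exact hl.2 ((hK ⟨l, ⟨hln, ha.of_sterile⟩, rfl⟩).trans hk)

theorem eventually_notMem_extinct_of_survives {d : ℕ} {N : SampleSpace d} {i : TypeSet d}
    {A : Set (TypeSet d)} {u : List (ℕ × TypeSet d)} (ha : (N.tree i).Alive u)
    (hs : (N.tree i).shift u ∈ FamilyTree.survives A (Individual.type (i, u))) :
    ∀ᶠ k in atTop, sterilize (A ∪ levelsUpTo d k) N ∉ extinct i Set.univ := by
  obtain ⟨K, hK⟩ := ha.exists_sterile (A := A) (i := i)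
  filter_upwards [eventually_ge_atTop K] with k hk h
  obtain ⟨n, hn⟩ := mem_extinct_iff.1 h
  obtain ⟨l, hl, hla, -⟩ := hs n
  refine hn (l ++ u) (by rw [List.length_append]; omega) ?_ trivial
  rw [tree_sterilize, FamilyTree.alive_append, FamilyTree.shift_sterile]
  -- The ancestry of `u` survives the truncation, and enlarging the set of fertile types keeps the
  -- descendance within `A`.
  exact ⟨hK k hk, hla.sterile_mono Set.subset_union_left⟩

theorem mainTheorem5 {d : ℕ} (Z : BlockLHBP d) (A : Set (TypeSet d))
    (hA : ∀ i : TypeSet d, ∃ j ∈ A, Z.HasPath i j)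
    (hsup : (⨆ i ∈ A, Z.qSterile A i) < 1) :
    Tendsto (fun k : ℕ => Z.qTrunc A k k) atTop (𝓝 (Z.q A)) := by
  refine tendsto_pi_nhds.2 fun i => ?_
  refine tendsto_measure_of_ae_tendsto_indicator_of_isFiniteMeasure atTop
    (measurableSet_extinct i A) (fun k => ?_) ?_
  · exact measurable_sterilize _ ((measurableSet_extinct i _).inter (measurableSet_extinctFrom i _ 0))
  filter_upwards [ae_all_iff.2 fun k => Z.ae_mem_extinct_levelsUpTo hA i k,
    Z.ae_exists_survives hsup i] with N hT hS
  by_cases hN : N ∈ extinct i A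
  · filter_upwards [eventually_mem_of_mem_extinct hN fun k => hT k hN] with k hk
    exact iff_of_true hk hN
  · obtain ⟨u, -, ha, hs⟩ := hS hN
    filter_upwards [eventually_notMem_extinct_of_survives ha hs] with k hk
    exact iff_of_false (fun h => hk h.1) hN
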